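/- Let $n\ge 3$ and let $\mathcal{K}^n$ be the set of convex bodies (nonempty compact convex sets) in $\mathbb{R}^n$, endowed with Minkowski addition and the Hausdorff metric. Let $r\in\mathbb{R}$ with $r\neq 1$ and $r\neq n+1$, and let $\Phi:\mathcal{K}^n\to\mathcal{K}^n$ be a map, continuous with respect to the Hausdorff metric, such that (a) $\Phi$ is a Minkowski valuation: $\Phi K+\Phi L=\Phi(K\cup L)+\Phi(K\cap L)$ whenever $K,\,L,\,K\cap L,\,K\cup L\in\mathcal{K}^n$; (b) $\Phi$ is $SL(n)$ equivariant: $\Phi(\phi K)=\phi\,\Phi K$ for all $\phi\in SL(n)$ (real matrices) and $K\in\mathcal{K}^n$; (c) $\Phi$ is (positively) homogeneous of degree $r$: $\Phi(\lambda K)=\lambda^r\,\Phi K$ for all $\lambda>0$ and $K\in\mathcal{K}^n$. Then $\Phi K=\{0\}$ for every $K\in\mathcal{K}^n$. -/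

import Mathlib

namespace MinkowskiValuation

/-- The space of convex bodies (nonempty compact convex sets) in Euclidean `ℝⁿ`. Mathlib equips it
with Minkowski addition, dilation by real scalars and the Hausdorff metric. -/
abbrev Body (n : ℕ) : Type := ConvexBody (EuclideanSpace ℝ (Fin n))

/-- The image `A K` of a convex body `K` under the linear map with matrix `A`. -/
def linImage {n : ℕ} (A : Matrix (Fin n) (Fin n) ℝ) (K : Body n) : Body n where
  carrier := Matrix.toEuclideanLin A '' (K : Set (EuclideanSpace ℝ (Fin n)))
  convex' := K.convex.linear_image _
  isCompact' := K.isCompact.image (LinearMap.continuous_of_finiteDimensional _)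
  nonempty' := K.nonempty.image _

/-- `Φ K + Φ L = Φ (K ∪ L) + Φ (K ∩ L)` whenever `K`, `L`, `K ∪ L` and `K ∩ L` are convex bodies;
`U` and `I` are the union and the intersection, as convex bodies. -/
def IsMinkowskiValuation {n : ℕ} (Φ : Body n → Body n) : Prop :=
  ∀ K L U I : Body n,
    (U : Set (EuclideanSpace ℝ (Fin n))) = (K : Set (EuclideanSpace ℝ (Fin n))) ∪ L →
    (I : Set (EuclideanSpace ℝ (Fin n))) = (K : Set (EuclideanSpace ℝ (Fin n))) ∩ L →
    Φ K + Φ L = Φ U + Φ I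

/-- `Φ (φ K) = φ (Φ K)` for all `φ ∈ SL(n)`. -/
def IsSLEquivariant {n : ℕ} (Φ : Body n → Body n) : Prop :=
  ∀ (φ : Matrix.SpecialLinearGroup (Fin n) ℝ) (K : Body n),
    Φ (linImage φ.1 K) = linImage φ.1 (Φ K)

/-- Positive homogeneity of real degree `r`: `Φ (l K) = l ^ r Φ K` for all `l > 0`. -/
def IsHomogeneousOfDegree {n : ℕ} (Φ : Body n → Body n) (r : ℝ) : Prop :=
  ∀ (l : ℝ) (K : Body n), 0 < l → Φ (l • K) = (l ^ r) • Φ K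

end MinkowskiValuation

namespace MinkowskiValuation

/-! ### Valuations that vanish on simplices vanish on polytopes -/

section Polyhedral

variable {E : Type*} [NormedAddCommGroup E] [NormedSpace ℝ E]

/-! Fix `u` and consider the real valuation sending `K` to the support function of `Φ K` at `u`. By
continuity it is enough that this vanishes on polytopes.

Homogeneity extends equivariance to matrices of positive determinant, with factor `det ^ q`, `q = (r
- 1) / n`. A body in a linear hyperplane is fixed by maps of every determinant `d > 0`; since `q ≠
0`, boundedness forces its image to be `{0}` (`map_eq_zero_of_subset_hyperplane`).

A simplex spanned by a basis, with or without the origin, is cut by a hyperplane through the origin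
into two linear copies of itself, of determinants `c` and `1 - c`. This gives a functional equation
in `u`. As `q ≠ 1`, its solution vanishes when `u` agrees on two basis vectors, and a third basis
vector reduces every `u` to that case (`supportAt_coordCell_eq_zero`).

No translation invariance is available, so only cuts through the origin have a negligible section.
`IsSimplexNull.polyhedron` dissects polytopes with such cuts, after treating slices by affine
hyperplanes (`IsSimplexNull.convexHull_union_slice`). -/

theorem isCompact_convexJoin {s t : Set E} (hs : IsCompact s) (ht : IsCompact t) :
    IsCompact (convexJoin ℝ s t) := by
  have h : convexJoin ℝ s t =
      (fun p : E × E × ℝ => (1 - p.2.2) • p.1 + p.2.2 • p.2.1) '' (s ×ˢ t ×ˢ Set.Icc (0 : ℝ) 1) := by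
    ext x
    simp only [mem_convexJoin, segment_eq_image, Set.mem_image, Set.mem_prod, Prod.exists]
    constructor
    · rintro ⟨a, ha, b, hb, c, hc, rfl⟩
      exact ⟨a, b, c, ⟨ha, hb, hc⟩, rfl⟩
    · rintro ⟨a, b, c, ⟨ha, hb, hc⟩, rfl⟩
      exact ⟨a, ha, b, hb, c, hc, rfl⟩
  rw [h]
  exact (hs.prod (ht.prod isCompact_Icc)).image (by fun_prop)

theorem isCompact_convexHull_finite_union {X C : Set E} (hX : X.Finite) (hC : IsCompact C)
    (hCc : Convex ℝ C) : IsCompact (convexHull ℝ (X ∪ C)) := by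
  rcases X.eq_empty_or_nonempty with rfl | hXn
  · rwa [Set.empty_union, hCc.convexHull_eq]
  rcases C.eq_empty_or_nonempty with rfl | hCn
  · rw [Set.union_empty]
    exact hX.isCompact_convexHull ℝ
  rw [convexHull_union hXn hCn, hCc.convexHull_eq]
  exact isCompact_convexJoin (hX.isCompact_convexHull ℝ) hC

/-- Cutting the hull of `X ∪ C` by a halfspace bounded by a hyperplane through `X`. -/
theorem convexHull_union_inter_halfspace {X C : Set E} (hC : Convex ℝ C) {v : E} (hv : v ∈ C)
    (l : E →L[ℝ] ℝ) (hX : ∀ x ∈ X, l x = 0) :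
    convexHull ℝ (X ∪ C) ∩ {x | l x ≤ 0} = convexHull ℝ (X ∪ (C ∩ {x | l x ≤ 0})) := by
  have hconv : Convex ℝ {x : E | l x ≤ 0} := convex_halfSpace_le l.toLinearMap.isLinear 0
  apply Set.Subset.antisymm
  · rcases X.eq_empty_or_nonempty with rfl | hXn
    · rw [Set.empty_union, Set.empty_union, hC.convexHull_eq]
      exact subset_convexHull ℝ _
    rintro x ⟨hx, hlx⟩
    rw [convexHull_union hXn ⟨v, hv⟩, hC.convexHull_eq, mem_convexJoin] at hx
    obtain ⟨y, hy, c, hc, s, t, hs, ht, hst, rfl⟩ := hx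
    have hly : l y = 0 := by
      have : convexHull ℝ X ⊆ {x : E | l x = 0} :=
        convexHull_min hX (convex_hyperplane l.toLinearMap.isLinear 0)
      exact this hy
    have hy' : y ∈ convexHull ℝ (X ∪ (C ∩ {x | l x ≤ 0})) :=
      convexHull_mono Set.subset_union_left hy
    rcases ht.eq_or_lt with rfl | ht
    · obtain rfl : s = 1 := by linarith
      simpa using hy'
    · have hlc : l c ≤ 0 := by
        simp only [Set.mem_ofPred_eq, map_add, map_smul, hly, smul_eq_mul, mul_zero, zero_add] at hlx
        by_contra! h
        exact absurd hlx (not_le.2 (mul_pos ht h))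
      exact convex_convexHull ℝ _ hy' (subset_convexHull ℝ _ (Or.inr ⟨hc, hlc⟩)) hs ht.le hst
  · refine convexHull_min ?_ ((convex_convexHull ℝ _).inter hconv)
    rintro x (hx | hx)
    · exact ⟨subset_convexHull ℝ _ (Or.inl hx), (hX x hx).le⟩
    · exact ⟨subset_convexHull ℝ _ (Or.inr hx.1), hx.2⟩

theorem eq_zero_of_isBounded_ray {C : Set E} (hC : Bornology.IsBounded C) {v w : E}
    (h : ∀ t : ℝ, 0 ≤ t → v + t • w ∈ C) : w = 0 := by
  obtain ⟨R, hR⟩ := hC.exists_norm_le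
  by_contra hw
  have hw' : 0 < ‖w‖ := norm_pos_iff.2 hw
  have hR0 : 0 ≤ R := (norm_nonneg _).trans (hR _ (h 0 le_rfl))
  set t : ℝ := (R + ‖v‖ + 1) / ‖w‖ with ht
  have ht0 : 0 ≤ t := by positivity
  have h1 := hR _ (h t ht0)
  have h2 : ‖t • w‖ ≤ ‖v + t • w‖ + ‖v‖ := by
    simpa using norm_sub_le (v + t • w) v
  rw [norm_smul, Real.norm_of_nonneg ht0, ht, div_mul_cancel₀ _ hw'.ne'] at h2
  linarith

/-- A real valued valuation on compact convex sets that vanishes on all sets in linear hyperplanes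
and on all hulls of finite sets with at most `dim E` nonzero elements. -/
structure IsSimplexNull (z : Set E → ℝ) : Prop where
  empty : z ∅ = 0
  cut : ∀ s : Set E, Convex ℝ s → IsCompact s → ∀ (g : E →L[ℝ] ℝ) (c : ℝ),
    z s + z (s ∩ {x | g x = c}) = z (s ∩ {x | g x ≤ c}) + z (s ∩ {x | c ≤ g x})
  hyperplane : ∀ s : Set E, Convex ℝ s → IsCompact s → ∀ g : E →L[ℝ] ℝ, g ≠ 0 →
    (∀ x ∈ s, g x = 0) → z s = 0
  simplex : ∀ X : Set E, X.Finite → (X \ {0}).ncard ≤ Module.finrank ℝ E → z (convexHull ℝ X) = 0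

theorem IsSimplexNull.cut_linear {z : Set E → ℝ} (hz : IsSimplexNull z) {s : Set E}
    (hs : Convex ℝ s) (hsc : IsCompact s) {g : E →L[ℝ] ℝ} (hg : g ≠ 0) :
    z s = z (s ∩ {x | g x ≤ 0}) + z (s ∩ {x | (-g) x ≤ 0}) := by
  have h := hz.cut s hs hsc g 0
  have hcl : IsClosed {x : E | g x = 0} := isClosed_eq g.continuous continuous_const
  rw [hz.hyperplane (s ∩ {x | g x = 0}) (hs.inter (convex_hyperplane g.toLinearMap.isLinear 0))
    (hsc.inter_right hcl) g hg (fun x hx => hx.2), add_zero] at h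
  simpa using h

/-- The part of `D` satisfying the constraints `f ≤ 0` for `f ∈ F₀` and `f ≤ 1` for `f ∈ F₁`. -/
def cell (D : Set E) (F₀ F₁ : List (E →L[ℝ] ℝ)) : Set E :=
  {x | x ∈ D ∧ (∀ f ∈ F₀, f x ≤ 0) ∧ ∀ f ∈ F₁, f x ≤ 1}

theorem convex_setOf_forall_le (F : List (E →L[ℝ] ℝ)) (c : ℝ) :
    Convex ℝ {x : E | ∀ f ∈ F, f x ≤ c} := by
  simp only [Set.ofPred_forall]
  exact convex_iInter₂ fun f _ => convex_halfSpace_le f.toLinearMap.isLinear c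

theorem isClosed_setOf_forall_le (F : List (E →L[ℝ] ℝ)) (c : ℝ) :
    IsClosed {x : E | ∀ f ∈ F, f x ≤ c} := by
  simp only [Set.ofPred_forall]
  exact isClosed_biInter fun f _ => isClosed_le f.continuous continuous_const

theorem convex_cell {D : Set E} (hD : Convex ℝ D) (F₀ F₁ : List (E →L[ℝ] ℝ)) :
    Convex ℝ (cell D F₀ F₁) :=
  hD.inter ((convex_setOf_forall_le F₀ 0).inter (convex_setOf_forall_le F₁ 1))

theorem isClosed_cell {D : Set E} (hD : IsClosed D) (F₀ F₁ : List (E →L[ℝ] ℝ)) :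
    IsClosed (cell D F₀ F₁) :=
  hD.inter ((isClosed_setOf_forall_le F₀ 0).inter (isClosed_setOf_forall_le F₁ 1))

/-- A bounded cell of a cone `D` with apex `v` is null if the hulls of `v` and its base are. -/
theorem IsSimplexNull.convexHull_union_cell [FiniteDimensional ℝ E] {z : Set E → ℝ}
    (hz : IsSimplexNull z) {X : Set E} (hX : X.Finite) {v : E} {D : Set E} (hD : Convex ℝ D)
    (hDcl : IsClosed D) (hvD : v ∈ D) (hcone : ∀ x ∈ D, ∀ t : ℝ, 0 ≤ t → v + t • (x - v) ∈ D)
    (h0 : z (convexHull ℝ (X ∪ {v})) = 0)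
    (h1 : ∀ (F₀ : List (E →L[ℝ] ℝ)) (f : E →L[ℝ] ℝ),
      (∀ g ∈ F₀, ∀ x ∈ insert v X, g x = 0) → (∀ x ∈ insert v X, f x = 0) →
      IsCompact {x | x ∈ D ∧ f x = 1 ∧ ∀ g ∈ F₀, g x ≤ 0} →
      {x | x ∈ D ∧ f x = 1 ∧ ∀ g ∈ F₀, g x ≤ 0}.Nonempty →
      z (convexHull ℝ (insert v X ∪ {x | x ∈ D ∧ f x = 1 ∧ ∀ g ∈ F₀, g x ≤ 0})) = 0)
    (F₁ F₀ : List (E →L[ℝ] ℝ)) (hF₀ : ∀ g ∈ F₀, ∀ x ∈ insert v X, g x = 0)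
    (hF₁ : ∀ g ∈ F₁, ∀ x ∈ insert v X, g x = 0)
    (hb : Bornology.IsBounded (cell D F₀ F₁)) :
    z (convexHull ℝ (X ∪ cell D F₀ F₁)) = 0 := by
  have hvX : v ∈ insert v X := Set.mem_insert v X
  have hray : ∀ F : List (E →L[ℝ] ℝ), (∀ g ∈ F, ∀ x ∈ insert v X, g x = 0) → ∀ x : E,
      (∀ g ∈ F, g x ≤ 0) → ∀ t : ℝ, 0 ≤ t → ∀ g ∈ F, g (v + t • (x - v)) ≤ 0 := by
    intro F hF x hx t ht g hg
    simpa [hF g hg v hvX] using mul_nonpos_of_nonneg_of_nonpos ht (hx g hg)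
  have hmem : ∀ F₀ F₁ : List (E →L[ℝ] ℝ), (∀ g ∈ F₀, ∀ x ∈ insert v X, g x = 0) →
      (∀ g ∈ F₁, ∀ x ∈ insert v X, g x = 0) → v ∈ cell D F₀ F₁ := fun F₀ F₁ h h' =>
    ⟨hvD, fun f hf => (h f hf v hvX).le, fun f hf => (h' f hf v hvX).le.trans zero_le_one⟩
  induction hN : F₁.length generalizing F₀ F₁ with
  | zero =>
    obtain rfl := List.length_eq_zero_iff.1 hN
    have : cell D F₀ [] = {v} := by
      refine Set.Subset.antisymm (fun x hx => ?_) (Set.singleton_subset_iff.2 (hmem _ _ hF₀ hF₁))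
      -- Without constraints `f ≤ 1` the cell is a cone with apex `v`, and a bounded cone is its
      -- apex.
      have := eq_zero_of_isBounded_ray hb (v := v) (w := x - v) fun t ht =>
        ⟨hcone x hx.1 t ht, hray F₀ hF₀ x hx.2.1 t ht, by simp⟩
      exact sub_eq_zero.1 this
    rw [this, h0]
  | succ N ih =>
    match F₁, hN, hF₁, hb with
    | [f], _, hF₁, hb =>
      have hfv : f v = 0 := hF₁ f (by simp) v hvX
      -- With a single constraint the cell is the pyramid with apex `v` over its base in `f = 1`;
      -- points with `f ≤ 0` would span unbounded rays.
      have hpos : ∀ x ∈ cell D F₀ [f], x ≠ v → 0 < f x := by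
        intro x hx hxv
        by_contra! hfx
        refine hxv (sub_eq_zero.1 (eq_zero_of_isBounded_ray hb (v := v) (w := x - v) ?_))
        refine fun t ht => ⟨hcone x hx.1 t ht, hray F₀ hF₀ x hx.2.1 t ht, ?_⟩
        intro g hg
        obtain rfl : g = f := by simpa using hg
        exact (hray [g] hF₁ x (by simpa using hfx) t ht g (by simp)).trans zero_le_one
      have hproj : ∀ x ∈ cell D F₀ [f], x ≠ v →
          v + (f x)⁻¹ • (x - v) ∈ {x | x ∈ D ∧ f x = 1 ∧ ∀ g ∈ F₀, g x ≤ 0} := by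
        intro x hx hxv
        have hfx := hpos x hx hxv
        refine ⟨hcone x hx.1 _ (inv_nonneg.2 hfx.le), ?_, hray F₀ hF₀ x hx.2.1 _
          (inv_nonneg.2 hfx.le)⟩
        simp [hfv, hfx.ne']
      rcases Set.eq_empty_or_nonempty {x | x ∈ D ∧ f x = 1 ∧ ∀ g ∈ F₀, g x ≤ 0} with he | hne
      · have : cell D F₀ [f] = {v} := by
          refine Set.Subset.antisymm (fun x hx => ?_)
            (Set.singleton_subset_iff.2 (hmem _ _ hF₀ hF₁))
          by_contra hxv
          have := hproj x hx hxv
          rw [he] at this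
          exact this
        rw [this, h0]
      · have hsub : {x | x ∈ D ∧ f x = 1 ∧ ∀ g ∈ F₀, g x ≤ 0} ⊆ cell D F₀ [f] :=
          fun x hx => ⟨hx.1, hx.2.2, by simp [hx.2.1]⟩
        have hcl : IsClosed {x | x ∈ D ∧ f x = 1 ∧ ∀ g ∈ F₀, g x ≤ 0} :=
          hDcl.inter ((isClosed_eq f.continuous continuous_const).inter
            (isClosed_setOf_forall_le F₀ 0))
        have key := h1 F₀ f hF₀ (hF₁ f (by simp))
          (Metric.isCompact_of_isClosed_isBounded hcl (hb.subset hsub)) hne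
        rw [← key]
        congr 1
        apply Set.Subset.antisymm
        · refine convexHull_min ?_ (convex_convexHull ℝ _)
          rintro x (hx | hx)
          · exact subset_convexHull ℝ _ (Or.inl (Or.inr hx))
          · have hv' := subset_convexHull ℝ
              (insert v X ∪ {x | x ∈ D ∧ f x = 1 ∧ ∀ g ∈ F₀, g x ≤ 0}) (Or.inl hvX)
            by_cases hxv : x = v
            · rwa [hxv]
            · have hfx := hpos x hx hxv
              have := convex_convexHull ℝ _ hv' (subset_convexHull ℝ _ (Or.inr (hproj x hx hxv)))
                (sub_nonneg.2 (hx.2.2 f (by simp))) hfx.le (by ring)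
              convert this using 1
              rw [smul_add, smul_smul, mul_inv_cancel₀ hfx.ne']
              module
        · refine convexHull_mono ?_
          rintro x ((rfl | hx) | hx)
          · exact Or.inr (hmem _ _ hF₀ hF₁)
          · exact Or.inl hx
          · exact Or.inr (hsub hx)
    | f :: g :: F, hN, hF₁, hb =>
      have hfX := hF₁ f (by simp)
      have hgX := hF₁ g (by simp)
      have hF : ∀ h ∈ F, ∀ x ∈ insert v X, h x = 0 := fun h hh => hF₁ h (by simp [hh])
      by_cases hfg : f = g
      · subst hfg
        have : cell D F₀ (f :: f :: F) = cell D F₀ (f :: F) := by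
          ext x; simp [cell]
        rw [this] at hb ⊢
        exact ih (f :: F) F₀ hF₀ (by simpa using ⟨by simpa using hfX, by simpa using hF⟩) hb
          (by simpa using hN)
      -- Cut along `f = g`, which contains `X` and `v`. On each side one of `f ≤ 1`, `g ≤ 1` implies
      -- the other, so `F₁` shrinks by one and `F₀` gains a homogeneous constraint.
      · have hl : f - g ≠ 0 := sub_ne_zero.2 hfg
        have hc := convex_cell hD F₀ (f :: g :: F)
        have hcl := isClosed_cell hDcl F₀ (f :: g :: F)
        have hv := hmem F₀ (f :: g :: F) hF₀ hF₁
        have e1 : cell D F₀ (f :: g :: F) ∩ {x | (f - g) x ≤ 0} =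
            cell D ((f - g) :: F₀) (g :: F) := by
          ext x
          simp only [cell, Set.mem_inter_iff, Set.mem_ofPred_eq, List.forall_mem_cons,
            sub_apply, sub_nonpos]
          constructor
          · tauto
          · rintro ⟨h1, ⟨h2, h3⟩, h4, h5⟩
            exact ⟨⟨h1, h3, h2.trans h4, h4, h5⟩, h2⟩
        have e2 : cell D F₀ (f :: g :: F) ∩ {x | (-(f - g)) x ≤ 0} =
            cell D ((-(f - g)) :: F₀) (f :: F) := by
          ext x
          simp only [cell, Set.mem_inter_iff, Set.mem_ofPred_eq, List.forall_mem_cons,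
            sub_apply, neg_sub, sub_nonpos]
          constructor
          · tauto
          · rintro ⟨h1, ⟨h2, h3⟩, h4, h5⟩
            exact ⟨⟨h1, h3, h4, h2.trans h4, h5⟩, h2⟩
        have hlX : ∀ x ∈ insert v X, (f - g) x = 0 := fun x hx => by
          simp [hfX x hx, hgX x hx]
        have hlX' : ∀ x ∈ insert v X, (-(f - g)) x = 0 := fun x hx => by
          rw [neg_apply, hlX x hx, neg_zero]
        rw [hz.cut_linear (convex_convexHull ℝ _) (isCompact_convexHull_finite_union hX
            (Metric.isCompact_of_isClosed_isBounded hcl hb) hc) hl,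
          convexHull_union_inter_halfspace hc hv _ (fun x hx => hlX x (Or.inr hx)),
          convexHull_union_inter_halfspace hc hv _ (fun x hx => hlX' x (Or.inr hx)),
          e1, e2]
        rw [ih (g :: F) ((f - g) :: F₀) (List.forall_mem_cons.2 ⟨hlX, hF₀⟩)
            (List.forall_mem_cons.2 ⟨hgX, hF⟩) (by rw [← e1]; exact hb.subset Set.inter_subset_left)
            (by simpa using hN),
          ih (f :: F) ((-(f - g)) :: F₀) (List.forall_mem_cons.2 ⟨hlX', hF₀⟩)
            (List.forall_mem_cons.2 ⟨hfX, hF⟩) (by rw [← e2]; exact hb.subset Set.inter_subset_left)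
            (by simpa using hN), add_zero]

/-- Constraints `f ≤ 0` on `{b = 1}`, rewritten relative to a point `v` satisfying them. -/
theorem exists_centered_constraints {X : Set E} {b : E →L[ℝ] ℝ} {v : E} (hbv : b v = 1)
    (hbX : ∀ x ∈ X, b x = 0) (F : List (E →L[ℝ] ℝ)) (hFX : ∀ f ∈ F, ∀ x ∈ X, f x = 0)
    (hFv : ∀ f ∈ F, f v ≤ 0) :
    ∃ F₀ F₁ : List (E →L[ℝ] ℝ), (∀ f ∈ F₀, ∀ x ∈ insert v X, f x = 0) ∧
      (∀ f ∈ F₁, ∀ x ∈ insert v X, f x = 0) ∧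
      ∀ x, b x = 1 → ((∀ f ∈ F, f x ≤ 0) ↔ (∀ f ∈ F₀, f x ≤ 0) ∧ ∀ f ∈ F₁, f x ≤ 1) := by
  induction F with
  | nil => exact ⟨[], [], by simp, by simp, by simp⟩
  | cons f F ih =>
    rw [List.forall_mem_cons] at hFX hFv
    obtain ⟨F₀, F₁, h0, h1, h⟩ := ih hFX.2 hFv.2
    have hl : ∀ x ∈ insert v X, (f - f v • b) x = 0 := by
      rintro x (rfl | hx)
      · simp [hbv]
      · simp [hbX x hx, hFX.1 x hx]
    rcases hFv.1.eq_or_lt with hfv | hfv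
    · refine ⟨f :: F₀, F₁, List.forall_mem_cons.2 ⟨by simpa [hfv] using hl, h0⟩, h1, ?_⟩
      intro x hx
      rw [List.forall_mem_cons, List.forall_mem_cons, h x hx]
      tauto
    -- Subtracting `f v • b` makes the functional vanish at `v`; on `b = 1` this only shifts the
    -- bound to `-f v > 0`, normalized to `1`.
    · refine ⟨F₀, (-f v)⁻¹ • (f - f v • b) :: F₁, h0, List.forall_mem_cons.2 ⟨?_, h1⟩, ?_⟩
      · intro x hx
        rw [smul_apply, hl x hx, smul_zero]
      · intro x hx
        have : ((-f v)⁻¹ • (f - f v • b)) x ≤ 1 ↔ f x ≤ 0 := by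
          rw [smul_apply, smul_eq_mul, inv_mul_le_iff₀ (neg_pos.2 hfv)]
          simp only [sub_apply, smul_apply, hx, smul_eq_mul]
          constructor <;> intro h <;> linarith
        rw [List.forall_mem_cons, List.forall_mem_cons, h x hx, this]
        tauto

/-- Induction on `finrank S`: the slice is a cell around one of its points `v`, and `v` is moved
into `X`. The new base satisfies `f = b = 1`, so it lies in `S ⊓ ker (f - b)`, which misses `v`
because `f v = 0` and `b v = 1`. The gain in `X` is paid for by the loss in dimension, so `hcard`
persists until a simplex remains. -/
theorem IsSimplexNull.convexHull_union_slice [FiniteDimensional ℝ E] {z : Set E → ℝ}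
    (hz : IsSimplexNull z) {X : Set E} (hX : X.Finite) (S : Submodule ℝ E)
    (hcard : (X \ {0}).ncard + Module.finrank ℝ S ≤ Module.finrank ℝ E)
    (b : E →L[ℝ] ℝ) (hb : ∀ x ∈ X, b x = 0) (F : List (E →L[ℝ] ℝ)) (hF : ∀ f ∈ F, ∀ x ∈ X, f x = 0)
    (hQ : IsCompact {x | x ∈ S ∧ b x = 1 ∧ ∀ f ∈ F, f x ≤ 0})
    (hQn : {x | x ∈ S ∧ b x = 1 ∧ ∀ f ∈ F, f x ≤ 0}.Nonempty) :
    z (convexHull ℝ (X ∪ {x | x ∈ S ∧ b x = 1 ∧ ∀ f ∈ F, f x ≤ 0})) = 0 := by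
  induction hd : Module.finrank ℝ S using Nat.strong_induction_on generalizing X S b F with
  | _ d ih =>
  subst hd
  obtain ⟨v, hvS, hbv, hvF⟩ := hQn
  have hv0 : v ≠ 0 := by rintro rfl; simp at hbv
  obtain ⟨F₀, F₁, hF₀, hF₁, hiff⟩ := exists_centered_constraints hbv hb F hF hvF
  have hQe : {x | x ∈ S ∧ b x = 1 ∧ ∀ f ∈ F, f x ≤ 0} = cell {x | x ∈ S ∧ b x = 1} F₀ F₁ := by
    ext x
    constructor
    · rintro ⟨h1, h2, h3⟩
      exact ⟨⟨h1, h2⟩, (hiff x h2).1 h3⟩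
    · rintro ⟨⟨h1, h2⟩, h3⟩
      exact ⟨h1, h2, (hiff x h2).2 h3⟩
  have hins : (insert v X \ {0}).ncard ≤ (X \ {0}).ncard + 1 := by
    rw [Set.insert_sdiff_of_notMem _ (by simpa using hv0)]
    exact Set.ncard_insert_le _ _
  rw [hQe] at hQ ⊢
  refine hz.convexHull_union_cell hX (S.convex.inter (convex_hyperplane b.toLinearMap.isLinear 1))
    (S.closed_of_finiteDimensional.inter (isClosed_eq b.continuous continuous_const))
    (v := v) (D := {x | x ∈ S ∧ b x = 1}) ⟨hvS, hbv⟩ ?_ ?_ ?_ F₁ F₀ hF₀ hF₁ hQ.isBounded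
  · rintro x ⟨hxS, hbx⟩ t -
    have hbx' : b x = 1 := hbx
    exact ⟨S.add_mem hvS (S.smul_mem t (S.sub_mem hxS hvS)), by simp [hbx', hbv]⟩
  · refine hz.simplex _ (hX.union (Set.finite_singleton v)) ?_
    rw [Set.union_singleton]
    have : 0 < Module.finrank ℝ S :=
      Module.finrank_pos_iff_exists_ne_zero.2 ⟨⟨v, hvS⟩, by simpa using hv0⟩
    omega
  · intro G f hG hf hc hn
    have hset : {x | x ∈ {x | x ∈ S ∧ b x = 1} ∧ f x = 1 ∧ ∀ g ∈ G, g x ≤ 0} =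
        {x | x ∈ S ⊓ LinearMap.ker (f - b).toLinearMap ∧ f x = 1 ∧ ∀ g ∈ G, g x ≤ 0} := by
      ext x
      simp only [Set.mem_ofPred_eq, Submodule.mem_inf, LinearMap.mem_ker,
        ContinuousLinearMap.coe_coe, sub_apply, sub_eq_zero]
      constructor
      · rintro ⟨⟨h1, h2⟩, h3, h4⟩
        exact ⟨⟨h1, h3.trans h2.symm⟩, h3, h4⟩
      · rintro ⟨⟨h1, h2⟩, h3, h4⟩
        exact ⟨⟨h1, h2.symm.trans h3⟩, h3, h4⟩
    have hlt : S ⊓ LinearMap.ker (f - b).toLinearMap < S := by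
      refine lt_of_le_of_ne inf_le_left fun h => ?_
      have : v ∈ S ⊓ LinearMap.ker (f - b).toLinearMap := h.ge hvS
      have h2 := this.2
      simp [hf v (Set.mem_insert v X), hbv] at h2
    have hfr := Submodule.finrank_lt_finrank_of_lt hlt
    rw [hset] at hc hn ⊢
    exact ih _ hfr (hX.insert v) _ (by omega) f hf G hG hc hn rfl

theorem IsSimplexNull.slice [FiniteDimensional ℝ E] {z : Set E → ℝ} (hz : IsSimplexNull z)
    (b : E →L[ℝ] ℝ) (F : List (E →L[ℝ] ℝ))
    (hQ : IsCompact {x | b x = 1 ∧ ∀ f ∈ F, f x ≤ 0}) :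
    z {x | b x = 1 ∧ ∀ f ∈ F, f x ≤ 0} = 0 := by
  rcases Set.eq_empty_or_nonempty {x | b x = 1 ∧ ∀ f ∈ F, f x ≤ 0} with he | hne
  · rw [he, hz.empty]
  have hconv : Convex ℝ {x | b x = 1 ∧ ∀ f ∈ F, f x ≤ 0} :=
    (convex_hyperplane b.toLinearMap.isLinear 1).inter (convex_setOf_forall_le F 0)
  have := hz.convexHull_union_slice (X := ∅) Set.finite_empty ⊤ (by simp) b (by simp) F (by simp)
    (by simpa using hQ) (by simpa using hne)
  simpa [hconv.convexHull_eq] using this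

theorem IsSimplexNull.cell_univ [FiniteDimensional ℝ E] {z : Set E → ℝ} (hz : IsSimplexNull z)
    (F₀ F₁ : List (E →L[ℝ] ℝ)) (hb : Bornology.IsBounded (cell Set.univ F₀ F₁)) :
    z (cell Set.univ F₀ F₁) = 0 := by
  have := hz.convexHull_union_cell (X := ∅) Set.finite_empty (v := 0) convex_univ isClosed_univ
    (Set.mem_univ _) (fun _ _ _ _ => Set.mem_univ _) (hz.simplex _ (by simp) (by simp)) ?_ F₁ F₀
    (by simp) (by simp) hb
  · simpa [(convex_cell convex_univ F₀ F₁).convexHull_eq] using this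
  · intro G f hG hf hc hn
    -- The apex `0` is not counted in `hcard`, so all of `E` is still allowed as `S`.
    simpa using hz.convexHull_union_slice (X := {0}) (Set.finite_singleton 0) ⊤ (by simp) f
      (by simp) G (by simp) (by simpa using hc) (by simpa using hn)

/-- Each constraint `1 ≤ g` is removed by cutting at `g = 1`. The section need not lie in a linear
hyperplane, but on it subtracting `g` makes all other inhomogeneous constraints homogeneous, so
`IsSimplexNull.slice` applies. -/
theorem IsSimplexNull.cell_inter [FiniteDimensional ℝ E] {z : Set E → ℝ} (hz : IsSimplexNull z)
    (G F₀ F₁ : List (E →L[ℝ] ℝ)) (hb : Bornology.IsBounded (cell Set.univ F₀ F₁)) :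
    z (cell Set.univ F₀ F₁ ∩ {x | ∀ g ∈ G, 1 ≤ g x}) = 0 := by
  induction G generalizing F₁ with
  | nil => simpa using hz.cell_univ F₀ F₁ hb
  | cons g G ih =>
    have hGc : Convex ℝ {x : E | ∀ g ∈ G, 1 ≤ g x} := by
      simp only [Set.ofPred_forall]
      exact convex_iInter₂ fun f _ => convex_halfSpace_ge f.toLinearMap.isLinear 1
    have hGcl : IsClosed {x : E | ∀ g ∈ G, 1 ≤ g x} := by
      simp only [Set.ofPred_forall]
      exact isClosed_biInter fun f _ => isClosed_le continuous_const f.continuous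
    have hc : IsCompact (cell Set.univ F₀ F₁ ∩ {x | ∀ g ∈ G, 1 ≤ g x}) :=
      Metric.isCompact_of_isClosed_isBounded ((isClosed_cell isClosed_univ _ _).inter hGcl)
        (hb.subset Set.inter_subset_left)
    have h := hz.cut _ ((convex_cell convex_univ _ _).inter hGc) hc g 1
    have e1 : cell Set.univ F₀ F₁ ∩ {x | ∀ g ∈ G, 1 ≤ g x} ∩ {x | g x = 1} =
        {x | g x = 1 ∧ ∀ f ∈ F₀ ++ F₁.map (fun f => f - g) ++ G.map (fun f => g - f), f x ≤ 0} := by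
      ext x
      simp only [cell, Set.mem_inter_iff, Set.mem_ofPred_eq, Set.mem_univ, true_and,
        List.mem_append, List.mem_map]
      constructor
      · rintro ⟨⟨⟨h0, h1⟩, h2⟩, h3⟩
        refine ⟨h3, ?_⟩
        rintro f ((hf | ⟨f, hf, rfl⟩) | ⟨f, hf, rfl⟩)
        · exact h0 f hf
        · simpa [h3] using h1 f hf
        · simpa [h3] using h2 f hf
      · rintro ⟨h3, h⟩
        refine ⟨⟨⟨fun f hf => h f (Or.inl (Or.inl hf)), fun f hf => ?_⟩, fun f hf => ?_⟩, h3⟩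
        · simpa [h3] using h _ (Or.inl (Or.inr ⟨f, hf, rfl⟩))
        · simpa [h3] using h _ (Or.inr ⟨f, hf, rfl⟩)
    have e2 : cell Set.univ F₀ F₁ ∩ {x | ∀ g ∈ G, 1 ≤ g x} ∩ {x | g x ≤ 1} =
        cell Set.univ F₀ (g :: F₁) ∩ {x | ∀ g ∈ G, 1 ≤ g x} := by
      ext x
      simp only [cell, Set.mem_inter_iff, Set.mem_ofPred_eq, List.forall_mem_cons]
      tauto
    have e3 : cell Set.univ F₀ F₁ ∩ {x | ∀ g ∈ G, 1 ≤ g x} ∩ {x | 1 ≤ g x} =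
        cell Set.univ F₀ F₁ ∩ {x | ∀ h ∈ g :: G, 1 ≤ h x} := by
      ext x
      simp only [cell, Set.mem_inter_iff, Set.mem_ofPred_eq, List.forall_mem_cons]
      tauto
    have hsub : cell Set.univ F₀ (g :: F₁) ⊆ cell Set.univ F₀ F₁ := by
      rintro x ⟨h0, h1, h2⟩
      exact ⟨h0, h1, (List.forall_mem_cons.1 h2).2⟩
    have hc1 := hc.inter_right (isClosed_eq g.continuous (continuous_const (y := (1 : ℝ))))
    rw [e1] at hc1
    rw [e1, e2, e3, ih F₁ hb, ih (g :: F₁) (hb.subset hsub), hz.slice g _ hc1] at h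
    linarith

/-- `z` vanishes on bounded intersections of finitely many halfspaces. -/
theorem IsSimplexNull.polyhedron [FiniteDimensional ℝ E] {z : Set E → ℝ} (hz : IsSimplexNull z)
    (P : List ((E →L[ℝ] ℝ) × ℝ)) (R : ℝ) (hR : 0 < R) (B : List (E →L[ℝ] ℝ))
    (hB : Bornology.IsBounded {x : E | ∀ f ∈ B, f x ≤ R}) :
    z ({x | ∀ f ∈ B, f x ≤ R} ∩ {x | ∀ p ∈ P, p.1 x ≤ p.2}) = 0 := by
  have hP : ∃ F₀ F₁ G : List (E →L[ℝ] ℝ), ∀ x, (∀ p ∈ P, p.1 x ≤ p.2) ↔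
      (∀ f ∈ F₀, f x ≤ 0) ∧ (∀ f ∈ F₁, f x ≤ 1) ∧ ∀ g ∈ G, 1 ≤ g x := by
    induction P with
    | nil => exact ⟨[], [], [], by simp⟩
    | cons p P ih =>
      obtain ⟨F₀, F₁, G, h⟩ := ih
      obtain ⟨f, c⟩ := p
      -- Division by `c` normalizes the bound; a negative `c` reverses the inequality and yields a
      -- constraint `1 ≤ g`.
      rcases lt_trichotomy c 0 with hc | rfl | hc
      · refine ⟨F₀, F₁, c⁻¹ • f :: G, fun x => ?_⟩
        have : 1 ≤ (c⁻¹ • f) x ↔ f x ≤ c := by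
          rw [smul_apply, smul_eq_mul, inv_mul_eq_div, one_le_div_of_neg hc]
        simp only [List.forall_mem_cons, h, this]
        tauto
      · refine ⟨f :: F₀, F₁, G, fun x => ?_⟩
        simp only [List.forall_mem_cons, h]
        tauto
      · refine ⟨F₀, c⁻¹ • f :: F₁, G, fun x => ?_⟩
        have : (c⁻¹ • f) x ≤ 1 ↔ f x ≤ c := by
          rw [smul_apply, smul_eq_mul, inv_mul_eq_div, div_le_one hc]
        simp only [List.forall_mem_cons, h, this]
        tauto
  obtain ⟨F₀, F₁, G, h⟩ := hP
  have hR1 : ∀ (f : E →L[ℝ] ℝ) (x : E), (R⁻¹ • f) x ≤ 1 ↔ f x ≤ R := fun f x => by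
    rw [smul_apply, smul_eq_mul, inv_mul_eq_div, div_le_one hR]
  -- The bounds from `B` go into `F₁`, so the cell stays bounded before the constraints in `G` are
  -- imposed.
  have hmem : ∀ x, x ∈ cell Set.univ F₀ (B.map (fun f => R⁻¹ • f) ++ F₁) ↔
      (∀ f ∈ B, f x ≤ R) ∧ (∀ f ∈ F₀, f x ≤ 0) ∧ ∀ f ∈ F₁, f x ≤ 1 := by
    intro x
    simp only [cell, Set.mem_ofPred_eq, Set.mem_univ, true_and, List.forall_mem_append,
      List.forall_mem_map, hR1]
    tauto
  rw [← hz.cell_inter G F₀ (B.map (fun f => R⁻¹ • f) ++ F₁)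
    (hB.subset fun x hx => ((hmem x).1 hx).1)]
  congr 1
  ext x
  rw [Set.mem_inter_iff, Set.mem_inter_iff, hmem]
  simp only [Set.mem_ofPred_eq, h]
  tauto

end Polyhedral

/-! ### Support functions turn Minkowski valuations into real valuations -/

section Support

variable {n : ℕ}

local notation "𝔼" => EuclideanSpace ℝ (Fin n)

/-- The support function of a convex body. -/
noncomputable def support (K : Body n) (u : EuclideanSpace ℝ (Fin n)) : ℝ :=
  sSup ((fun x => inner ℝ x u) '' (K : Set (EuclideanSpace ℝ (Fin n))))

theorem bddAbove_inner_image (K : Body n) (u : 𝔼) :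
    BddAbove ((fun x => inner ℝ x u) '' (K : Set 𝔼)) :=
  (K.isCompact.image (by fun_prop)).bddAbove

theorem inner_le_support {K : Body n} {x : 𝔼} (hx : x ∈ (K : Set 𝔼)) (u : 𝔼) :
    inner ℝ x u ≤ support K u :=
  le_csSup (bddAbove_inner_image K u) (Set.mem_image_of_mem _ hx)

theorem support_add (K L : Body n) (u : 𝔼) : support (K + L) u = support K u + support L u := by
  rw [support, support, support, ← csSup_add (K.nonempty.image _) (bddAbove_inner_image K u)
    (L.nonempty.image _) (bddAbove_inner_image L u), ConvexBody.coe_add]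
  congr 1
  ext t
  simp only [Set.mem_image, Set.mem_add]
  constructor
  · rintro ⟨_, ⟨x, hx, y, hy, rfl⟩, rfl⟩
    exact ⟨_, ⟨x, hx, rfl⟩, _, ⟨y, hy, rfl⟩, (inner_add_left x y u).symm⟩
  · rintro ⟨_, ⟨x, hx, rfl⟩, _, ⟨y, hy, rfl⟩, rfl⟩
    exact ⟨_, ⟨x, hx, y, hy, rfl⟩, inner_add_left x y u⟩

theorem support_smul {c : ℝ} (hc : 0 ≤ c) (K : Body n) (u : 𝔼) :
    support (c • K) u = c * support K u := by
  rw [support, support, ← smul_eq_mul, ← Real.sSup_smul_of_nonneg hc, ConvexBody.coe_smul]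
  congr 1
  ext t
  simp [Set.mem_smul_set, inner_smul_left]

theorem support_linImage (A : Matrix (Fin n) (Fin n) ℝ) (K : Body n) (u : 𝔼) :
    support (linImage A K) u = support K (LinearMap.adjoint (Matrix.toEuclideanLin A) u) := by
  have : ((linImage A K : Body n) : Set 𝔼) = Matrix.toEuclideanLin A '' (K : Set 𝔼) := rfl
  rw [support, support, this, Set.image_image]
  simp only [LinearMap.adjoint_inner_right]

theorem eq_zero_of_support_eq_zero {K : Body n} (h : ∀ u, support K u = 0) : K = 0 := by
  have h0 : ∀ x ∈ (K : Set 𝔼), x = 0 := fun x hx =>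
    inner_self_eq_zero (𝕜 := ℝ).1 (le_antisymm ((inner_le_support hx x).trans (h x).le)
      real_inner_self_nonneg)
  apply ConvexBody.ext
  rw [ConvexBody.coe_zero]
  obtain ⟨x, hx⟩ := K.nonempty
  exact Set.Subset.antisymm h0 (Set.singleton_subset_iff.2 (h0 x hx ▸ hx))

open Classical in
/-- The support function of `Φ s` at `u`, set to zero if `s` is not a convex body. -/
noncomputable def supportAt (Φ : Body n → Body n) (u : EuclideanSpace ℝ (Fin n))
    (s : Set (EuclideanSpace ℝ (Fin n))) : ℝ :=
  if h : Convex ℝ s ∧ IsCompact s ∧ s.Nonempty then support (Φ ⟨s, h.1, h.2.1, h.2.2⟩) u else 0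

variable {Φ : Body n → Body n}

theorem supportAt_coe (Φ : Body n → Body n) (u : 𝔼) (K : Body n) :
    supportAt Φ u (K : Set 𝔼) = support (Φ K) u :=
  dif_pos ⟨K.convex, K.isCompact, K.nonempty⟩

theorem supportAt_empty (Φ : Body n → Body n) (u : 𝔼) : supportAt Φ u ∅ = 0 :=
  dif_neg fun h => Set.not_nonempty_empty h.2.2

theorem supportAt_cut (hval : IsMinkowskiValuation Φ) (u : 𝔼) (s : Set 𝔼) (hs : Convex ℝ s)
    (hsc : IsCompact s) (g : 𝔼 →L[ℝ] ℝ) (c : ℝ) :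
    supportAt Φ u s + supportAt Φ u (s ∩ {x | g x = c}) =
      supportAt Φ u (s ∩ {x | g x ≤ c}) + supportAt Φ u (s ∩ {x | c ≤ g x}) := by
  have hlec : Convex ℝ (s ∩ {x | g x ≤ c}) :=
    hs.inter (convex_halfSpace_le g.toLinearMap.isLinear c)
  have hgec : Convex ℝ (s ∩ {x | c ≤ g x}) :=
    hs.inter (convex_halfSpace_ge g.toLinearMap.isLinear c)
  have heqc : Convex ℝ (s ∩ {x | g x = c}) :=
    hs.inter (convex_hyperplane g.toLinearMap.isLinear c)
  have hle : IsCompact (s ∩ {x | g x ≤ c}) :=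
    hsc.inter_right (isClosed_le g.continuous continuous_const)
  have hge : IsCompact (s ∩ {x | c ≤ g x}) :=
    hsc.inter_right (isClosed_le continuous_const g.continuous)
  have heq : IsCompact (s ∩ {x | g x = c}) :=
    hsc.inter_right (isClosed_eq g.continuous continuous_const)
  rcases (s ∩ {x | g x ≤ c}).eq_empty_or_nonempty with h1 | h1
  · have e1 : s ∩ {x | g x = c} = ∅ :=
      Set.subset_empty_iff.1 fun x hx => h1.le ⟨hx.1, (show g x = c from hx.2).le⟩
    have e2 : s ∩ {x | c ≤ g x} = s := by
      refine Set.inter_eq_left.2 fun x hx => ?_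
      by_contra h
      exact h1.le ⟨hx, (not_le.1 (show ¬ c ≤ g x from h)).le⟩
    rw [h1, e1, e2, add_comm]
  rcases (s ∩ {x | c ≤ g x}).eq_empty_or_nonempty with h2 | h2
  · have e1 : s ∩ {x | g x = c} = ∅ :=
      Set.subset_empty_iff.1 fun x hx => h2.le ⟨hx.1, (show g x = c from hx.2).ge⟩
    have e2 : s ∩ {x | g x ≤ c} = s := by
      refine Set.inter_eq_left.2 fun x hx => ?_
      by_contra h
      exact h2.le ⟨hx, (not_le.1 (show ¬ g x ≤ c from h)).le⟩
    rw [h2, e1, e2]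
  -- The valuation property needs four nonempty bodies; connectedness of `s` supplies the section.
  have h3 : (s ∩ {x | g x = c}).Nonempty := by
    obtain ⟨x, hx, hxc⟩ := h1
    obtain ⟨y, hy, hyc⟩ := h2
    obtain ⟨w, hw, hwc⟩ := hs.isPreconnected.intermediate_value hx hy g.continuous.continuousOn
      ⟨hxc, hyc⟩
    exact ⟨w, hw, hwc⟩
  have hsn : s.Nonempty := h1.mono Set.inter_subset_left
  have key := hval ⟨_, hlec, hle, h1⟩ ⟨_, hgec, hge, h2⟩ ⟨s, hs, hsc, hsn⟩ ⟨_, heqc, heq, h3⟩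
    (by
      simp only [ConvexBody.coe_mk, ← Set.inter_union_distrib_left]
      exact (Set.inter_eq_left.2 fun x _ => le_total (g x) c).symm)
    (by
      simp only [ConvexBody.coe_mk]
      ext x
      simp only [Set.mem_inter_iff, Set.mem_ofPred_eq, le_antisymm_iff]
      tauto)
  have key' := congrArg (fun K => support K u) key
  rw [support_add, support_add] at key'
  simp only [← supportAt_coe, ConvexBody.coe_mk] at key'
  exact key'.symm

end Support

/-! ### Maps of positive determinant and bodies in hyperplanes -/

section Equivariance

open scoped Pointwise

variable {n : ℕ} {Φ : Body n → Body n} {r : ℝ}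

local notation "𝔼" => EuclideanSpace ℝ (Fin n)

/-- Write `A = c • (c⁻¹ • A)` with `c = det A ^ (1 / n)`, the second factor being in `SL(n)`.
Homogeneity contributes `c ^ r` and the matrix `c⁻¹`. -/
theorem map_linImage_of_det_pos (hn : n ≠ 0) (hequi : IsSLEquivariant Φ)
    (hhom : IsHomogeneousOfDegree Φ r) {A : Matrix (Fin n) (Fin n) ℝ} (hA : 0 < A.det)
    (K : Body n) : Φ (linImage A K) = (A.det ^ ((r - 1) / n)) • linImage A (Φ K) := by
  have hn' : (n : ℝ) ≠ 0 := Nat.cast_ne_zero.2 hn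
  set c : ℝ := A.det ^ (1 / (n : ℝ)) with hc
  have hc0 : 0 < c := Real.rpow_pos_of_pos hA _
  have hcn : c ^ n = A.det := by
    rw [hc, ← Real.rpow_natCast, ← Real.rpow_mul hA.le, one_div_mul_cancel hn', Real.rpow_one]
  have hdet : (c⁻¹ • A).det = 1 := by
    rw [Matrix.det_smul, Fintype.card_fin, inv_pow, hcn, inv_mul_cancel₀ hA.ne']
  have himg : ∀ L : Body n, linImage (c⁻¹ • A) L = c⁻¹ • linImage A L := by
    intro L
    apply ConvexBody.ext
    rw [ConvexBody.coe_smul]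
    change Matrix.toEuclideanLin (c⁻¹ • A) '' (L : Set 𝔼) =
      c⁻¹ • (Matrix.toEuclideanLin A '' (L : Set 𝔼))
    rw [map_smul, ← Set.image_smul, Set.image_image]
    rfl
  have h := hequi ⟨c⁻¹ • A, hdet⟩ K
  simp only [himg] at h
  have h2 := hhom c (c⁻¹ • linImage A K) hc0
  rw [smul_smul, mul_inv_cancel₀ hc0.ne', one_smul, h, smul_smul] at h2
  rw [h2]
  congr 1
  rw [← Real.rpow_neg_one, ← Real.rpow_add hc0, hc, ← Real.rpow_mul hA.le]
  congr 1
  field_simp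
  ring

theorem supportAt_image (hn : n ≠ 0) (hequi : IsSLEquivariant Φ) (hhom : IsHomogeneousOfDegree Φ r)
    {f : 𝔼 →ₗ[ℝ] 𝔼} (hf : 0 < LinearMap.det f) (K : Body n) (u : 𝔼) :
    supportAt Φ u (f '' (K : Set 𝔼)) =
      LinearMap.det f ^ ((r - 1) / n) * supportAt Φ (LinearMap.adjoint f u) (K : Set 𝔼) := by
  obtain ⟨A, rfl⟩ := (Matrix.toEuclideanLin (𝕜 := ℝ) (m := Fin n) (n := Fin n)).surjective f
  have hdet : LinearMap.det (Matrix.toEuclideanLin A) = A.det := by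
    rw [Matrix.toEuclideanLin_eq_toLin_orthonormal, LinearMap.det_toLin]
  rw [hdet] at hf ⊢
  change supportAt Φ u ((linImage A K : Body n) : Set 𝔼) = _
  rw [supportAt_coe, supportAt_coe, map_linImage_of_det_pos hn hequi hhom hf,
    support_smul (Real.rpow_nonneg hf.le _), support_linImage]

theorem map_eq_zero_of_subset_hyperplane (hn : 2 ≤ n) (hr : r ≠ 1) (hequi : IsSLEquivariant Φ)
    (hhom : IsHomogeneousOfDegree Φ r) {K : Body n} {l : 𝔼 →L[ℝ] ℝ} (hl : l ≠ 0)
    (hK : ∀ x ∈ (K : Set 𝔼), l x = 0) : Φ K = 0 := by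
  have hn0 : (n : ℝ) ≠ 0 := Nat.cast_ne_zero.2 (by omega)
  have hq : (r - 1) / n ≠ 0 := div_ne_zero (sub_ne_zero.2 hr) hn0
  obtain ⟨R, hR⟩ := (Φ K).isBounded.exists_norm_le
  have key : ∀ e : 𝔼, l e = 1 → ∀ x ∈ (Φ K : Set 𝔼), x = l x • e := by
    intro e he x hx
    set y := x - l x • e with hy
    have hmem : ∀ d : ℝ, 0 < d →
        d ^ ((r - 1) / n) • (x + (d - 1) • l x • e) ∈ (Φ K : Set 𝔼) := by
      intro d hd
      -- This map fixes `ker l`, hence `K`, and sends `e` to `d • e`, so its determinant is `d`.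
      -- Thus `Φ K` is invariant under `d ^ q • f`, which scales the `ker l` component `y` by `d ^
      -- q`.
      let f : 𝔼 →ₗ[ℝ] 𝔼 := LinearMap.transvection l.toLinearMap ((d - 1) • e)
      obtain ⟨A, hA⟩ := (Matrix.toEuclideanLin (𝕜 := ℝ) (m := Fin n) (n := Fin n)).surjective f
      have hdet : A.det = d := by
        have : LinearMap.det (Matrix.toEuclideanLin A) = A.det := by
          rw [Matrix.toEuclideanLin_eq_toLin_orthonormal, LinearMap.det_toLin]
        rw [← this, hA, LinearMap.transvection.det]
        simp [he]
      have hAK : linImage A K = K := by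
        apply ConvexBody.ext
        change Matrix.toEuclideanLin A '' (K : Set 𝔼) = K
        rw [hA, Set.EqOn.image_eq_self]
        intro z hz
        simp [f, LinearMap.transvection.apply, hK z hz]
      have h := map_linImage_of_det_pos (by omega) hequi hhom (hdet ▸ hd) K
      rw [hAK, hdet] at h
      rw [h, ConvexBody.coe_smul]
      refine Set.smul_mem_smul_set ⟨x, hx, ?_⟩
      rw [hA]
      simp only [f, LinearMap.transvection.apply, ContinuousLinearMap.coe_coe]
      module
    have hbd : ∀ d : ℝ, 0 < d → d ^ ((r - 1) / n) * ‖y‖ ≤ R + ‖l‖ * R * ‖e‖ := by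
      intro d hd
      have hp := hmem d hd
      set p := d ^ ((r - 1) / n) • (x + (d - 1) • l x • e) with hpdef
      have hpy : d ^ ((r - 1) / n) • y = p - l p • e := by
        rw [hpdef, hy]
        simp only [map_smul, map_add, he, smul_eq_mul]
        module
      have h1 : ‖l p • e‖ ≤ ‖l‖ * R * ‖e‖ := by
        rw [norm_smul]
        gcongr
        exact (l.le_opNorm p).trans (by gcongr; exact hR p hp)
      calc d ^ ((r - 1) / n) * ‖y‖ = ‖d ^ ((r - 1) / n) • y‖ := by
            rw [norm_smul, Real.norm_of_nonneg (Real.rpow_nonneg hd.le _)]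
        _ ≤ ‖p‖ + ‖l p • e‖ := by rw [hpy]; exact norm_sub_le _ _
        _ ≤ _ := add_le_add (hR p hp) h1
    by_contra hne
    have hy0 : 0 < ‖y‖ := norm_pos_iff.2 (sub_ne_zero.2 hne)
    set M : ℝ := R + ‖l‖ * R * ‖e‖
    have hR0 : 0 ≤ R := (norm_nonneg _).trans (hR x hx)
    have hM : 0 ≤ M := by positivity
    have ht : 0 < (M + 1) / ‖y‖ := by positivity
    -- For this `d` the left side of `hbd` is `M + 1`; the exponent exists because `r ≠ 1`.
    have := hbd (((M + 1) / ‖y‖) ^ ((r - 1) / n)⁻¹) (Real.rpow_pos_of_pos ht _)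
    rw [← Real.rpow_mul ht.le, inv_mul_cancel₀ hq, Real.rpow_one, div_mul_cancel₀ _ hy0.ne'] at this
    linarith
  obtain ⟨e₀, he₀⟩ : ∃ e, l e ≠ 0 := by
    by_contra! h
    exact hl (ContinuousLinearMap.ext h)
  have he : l ((l e₀)⁻¹ • e₀) = 1 := by simp [he₀]
  set e := (l e₀)⁻¹ • e₀
  -- Since `n ≥ 2`, both `e` and `e + w` are admissible directions, and only `0` is a multiple of
  -- both.
  obtain ⟨w, hw, hw0⟩ : ∃ w, l w = 0 ∧ w ≠ 0 := by
    have h1 := LinearMap.finrank_range_add_finrank_ker l.toLinearMap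
    have h2 : Module.finrank ℝ (LinearMap.range l.toLinearMap) ≤ 1 := by
      simpa using Submodule.finrank_le (LinearMap.range l.toLinearMap)
    rw [finrank_euclideanSpace_fin] at h1
    have h3 : 0 < Module.finrank ℝ (LinearMap.ker l.toLinearMap) := by omega
    obtain ⟨w, hw⟩ := Module.finrank_pos_iff_exists_ne_zero.1 h3
    exact ⟨w, w.2, by simpa using hw⟩
  have hzero : ∀ x ∈ (Φ K : Set 𝔼), x = 0 := by
    intro x hx
    have h1 := key e he x hx
    have h2 := key (e + w) (by simp [he, hw]) x hx
    have h3 : l x • w = 0 := by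
      rw [smul_add, ← h1] at h2
      simpa using h2.symm
    rcases smul_eq_zero.1 h3 with h | h
    · rw [h1, h, zero_smul]
    · exact absurd h hw0
  apply ConvexBody.ext
  rw [ConvexBody.coe_zero]
  obtain ⟨x, hx⟩ := (Φ K).nonempty
  exact Set.Subset.antisymm hzero (Set.singleton_subset_iff.2 (hzero x hx ▸ hx))

end Equivariance

/-! ### Self-similar dissection of a simplex -/

section Simplex

variable {ι E : Type*} [NormedAddCommGroup E] [NormedSpace ℝ E]

/-- The linear map fixing `b k` for `k ≠ i` and mapping `b i` to `c b i + (1 - c) b j`. -/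
noncomputable def slide (b : Module.Basis ι ℝ E) (i j : ι) (c : ℝ) : E →ₗ[ℝ] E :=
  LinearMap.transvection (b.coord i) ((1 - c) • (b j - b i))

theorem slide_apply (b : Module.Basis ι ℝ E) (i j : ι) (c : ℝ) (x : E) :
    slide b i j c x = x + ((1 - c) * b.repr x i) • (b j - b i) := by
  rw [slide, LinearMap.transvection.apply, Module.Basis.coord_apply, smul_smul, mul_comm]

theorem det_slide [FiniteDimensional ℝ E] (b : Module.Basis ι ℝ E) {i j : ι} (hij : i ≠ j) (c : ℝ) :
    LinearMap.det (slide b i j c) = c := by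
  classical
  rw [slide, LinearMap.transvection.det]
  simp [hij.symm]

variable [Fintype ι]

/-- Points with nonnegative coordinates whose sum lies in `I`. -/
def coordCell (b : Module.Basis ι ℝ E) (I : Set ℝ) : Set E :=
  {x | (∀ i, 0 ≤ b.repr x i) ∧ ∑ i, b.repr x i ∈ I}

theorem convex_coordCell (b : Module.Basis ι ℝ E) {I : Set ℝ} (hI : Convex ℝ I) :
    Convex ℝ (coordCell b I) := by
  rintro x ⟨hx, hxI⟩ y ⟨hy, hyI⟩ s t hs ht hst
  refine ⟨fun i => ?_, ?_⟩
  · simpa using add_nonneg (mul_nonneg hs (hx i)) (mul_nonneg ht (hy i))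
  · have := hI hxI hyI hs ht hst
    simpa [Finset.sum_add_distrib, Finset.mul_sum] using this

theorem convexHull_range_basis (b : Module.Basis ι ℝ E) :
    convexHull ℝ (Set.range b) = coordCell b {1} := by
  classical
  apply Set.Subset.antisymm
  · refine convexHull_min ?_ (convex_coordCell b (convex_singleton 1))
    rintro _ ⟨i, rfl⟩
    refine ⟨fun j => ?_, by simp [Finsupp.single_apply]⟩
    rw [b.repr_self, Finsupp.single_apply]
    split_ifs <;> simp
  · rintro x ⟨hx, hx1⟩
    rw [← b.sum_repr x]
    exact (convex_convexHull ℝ _).sum_mem (fun i _ => hx i) hx1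
      fun i _ => subset_convexHull ℝ _ (Set.mem_range_self i)

theorem convexHull_insert_zero_range_basis (b : Module.Basis ι ℝ E) :
    convexHull ℝ (insert 0 (Set.range b)) = coordCell b (Set.Icc 0 1) := by
  classical
  apply Set.Subset.antisymm
  · refine convexHull_min ?_ (convex_coordCell b (convex_Icc 0 1))
    rintro _ (rfl | ⟨i, rfl⟩)
    · simp [coordCell]
    refine ⟨fun j => ?_, by simp [Finsupp.single_apply]⟩
    rw [b.repr_self, Finsupp.single_apply]
    split_ifs <;> simp
  · rintro x ⟨hx, hx0, hx1⟩
    have h0 : (0 : E) ∈ convexHull ℝ (insert 0 (Set.range b)) :=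
      subset_convexHull ℝ _ (Set.mem_insert _ _)
    -- The index `none` stands for the vertex `0`, which takes the leftover weight.
    have := (convex_convexHull ℝ (insert 0 (Set.range b))).sum_mem (t := Finset.univ)
      (w := fun o : Option ι => o.elim (1 - ∑ i, b.repr x i) fun i => b.repr x i)
      (z := fun o : Option ι => o.elim 0 b) ?_ ?_ ?_
    · simpa [Fintype.sum_option, b.sum_repr] using this
    · rintro (_ | i) -
      · simpa using hx1
      · exact hx i
    · simp [Fintype.sum_option]
    · rintro (_ | i) -
      · exact h0
      · exact subset_convexHull ℝ _ (Or.inr (Set.mem_range_self i))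

/-- A slide moves the share `1 - c` of the `i`th coordinate to the `j`th. The coordinate sum is
preserved, so `I` is arbitrary and simplices with and without the vertex `0` are handled together.
-/
theorem image_slide_coordCell (b : Module.Basis ι ℝ E) (I : Set ℝ) {i j : ι} (hij : i ≠ j) {c : ℝ}
    (hc0 : 0 < c) (hc1 : c ≤ 1) :
    slide b i j c '' coordCell b I =
      coordCell b I ∩ {x | (1 - c) * b.repr x i ≤ c * b.repr x j} := by
  classical
  have hrep : ∀ (x : E) (t : ℝ) (k : ι), b.repr (x + t • (b j - b i)) k =
      b.repr x k + t * ((if j = k then 1 else 0) - if i = k then 1 else 0) := by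
    intro x t k
    simp [Finsupp.single_apply]
  have hsum : ∀ (x : E) (t : ℝ), ∑ k, b.repr (x + t • (b j - b i)) k = ∑ k, b.repr x k := by
    intro x t
    simp only [hrep, Finset.sum_add_distrib, ← Finset.mul_sum, Finset.sum_sub_distrib,
      Finset.sum_ite_eq, Finset.mem_univ, if_true, sub_self, mul_zero, add_zero]
  have hc1' : 0 ≤ 1 - c := sub_nonneg.2 hc1
  apply Set.Subset.antisymm
  · rintro _ ⟨x, ⟨hx, hxI⟩, rfl⟩
    rw [slide_apply]
    refine ⟨⟨fun k => ?_, by rwa [hsum]⟩, ?_⟩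
    · rw [hrep]
      have h1 := mul_nonneg hc1' (hx i)
      have h2 := mul_nonneg hc0.le (hx i)
      by_cases hik : i = k
      · subst hik
        simp only [if_neg hij.symm, if_true]
        linarith
      · simp only [if_neg hik, sub_zero]
        have := hx k
        split_ifs <;> linarith
    · simp only [Set.mem_ofPred_eq, hrep, if_neg hij, if_neg hij.symm, if_true]
      have := mul_nonneg hc0.le (hx j)
      linarith
  · rintro x ⟨⟨hx, hxI⟩, hle⟩
    have hle' : (1 - c) * b.repr x i ≤ c * b.repr x j := hle
    set t := -((1 - c) / c * b.repr x i) with ht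
    have hct : c * t = -((1 - c) * b.repr x i) := by rw [ht]; field_simp
    refine ⟨x + t • (b j - b i), ⟨fun k => ?_, by rwa [hsum]⟩, ?_⟩
    · have htn : t ≤ 0 := neg_nonpos.2 (mul_nonneg (div_nonneg hc1' hc0.le) (hx i))
      rw [hrep]
      by_cases hjk : j = k
      · subst hjk
        simp only [if_neg hij, if_true]
        have : 0 ≤ c * (b.repr x j + t) := by linarith
        have := nonneg_of_mul_nonneg_right this hc0
        linarith
      · simp only [if_neg hjk]
        have := hx k
        split_ifs <;> linarith
    · rw [slide_apply, hrep]
      simp only [if_neg hij.symm, if_true]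
      rw [add_assoc, ← add_smul]
      have : t + (1 - c) * (b.repr x i + t * (0 - 1)) = 0 := by linarith
      rw [this, zero_smul, add_zero]

end Simplex

/-! ### Vanishing on simplices and approximation by polytopes -/

section SimplexValues

variable {n : ℕ} {Φ : Body n → Body n} {r : ℝ}

local notation "𝔼" => EuclideanSpace ℝ (Fin n)

theorem supportAt_hyperplane (hn : 2 ≤ n) (hr : r ≠ 1) (hequi : IsSLEquivariant Φ)
    (hhom : IsHomogeneousOfDegree Φ r) (u : 𝔼) (s : Set 𝔼) (hs : Convex ℝ s) (hsc : IsCompact s)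
    (l : 𝔼 →L[ℝ] ℝ) (hl : l ≠ 0) (hsl : ∀ x ∈ s, l x = 0) : supportAt Φ u s = 0 := by
  rcases s.eq_empty_or_nonempty with rfl | hne
  · exact supportAt_empty Φ u
  have h := supportAt_coe Φ u ⟨s, hs, hsc, hne⟩
  rw [ConvexBody.coe_mk] at h
  rw [h, map_eq_zero_of_subset_hyperplane hn hr hequi hhom hl hsl, support, ConvexBody.coe_zero]
  simp

theorem inner_adjoint_slide (b : Module.Basis (Fin n) ℝ 𝔼) (i j : Fin n) (c : ℝ) (x u : 𝔼) :
    inner ℝ x (LinearMap.adjoint (slide b i j c) u) =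
      inner ℝ x u + (1 - c) * b.repr x i * (inner ℝ (b j) u - inner ℝ (b i) u) := by
  rw [LinearMap.adjoint_inner_right, slide_apply, inner_add_left, inner_smul_left, inner_sub_left]
  rfl

/-- The hyperplane `(1 - c) xᵢ = c xⱼ` cuts the cell into its images under two slides of
determinants `c` and `1 - c`; the section is negligible. -/
theorem supportAt_coordCell_cut (hn : 2 ≤ n) (hr : r ≠ 1) (hval : IsMinkowskiValuation Φ)
    (hequi : IsSLEquivariant Φ) (hhom : IsHomogeneousOfDegree Φ r)
    (b : Module.Basis (Fin n) ℝ 𝔼) {I : Set ℝ} (hI : Convex ℝ I)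
    (hIc : IsCompact (coordCell b I)) (hIn : (coordCell b I).Nonempty) {i j : Fin n} (hij : i ≠ j)
    {c : ℝ} (hc0 : 0 < c) (hc1 : c < 1) (u : 𝔼) :
    supportAt Φ u (coordCell b I) =
      c ^ ((r - 1) / n) * supportAt Φ (LinearMap.adjoint (slide b i j c) u) (coordCell b I) +
      (1 - c) ^ ((r - 1) / n) *
        supportAt Φ (LinearMap.adjoint (slide b j i (1 - c)) u) (coordCell b I) := by
  have hn0 : n ≠ 0 := by omega
  have hconv := convex_coordCell b hI
  let g : 𝔼 →L[ℝ] ℝ := LinearMap.toContinuousLinearMap ((1 - c) • b.coord i - c • b.coord j)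
  have hg : ∀ x, g x = (1 - c) * b.repr x i - c * b.repr x j := fun x => by simp [g]
  have hg0 : g ≠ 0 := by
    intro h
    have := hg (b i)
    rw [h] at this
    simp [hij] at this
    linarith
  have h1 := image_slide_coordCell b I hij hc0 hc1.le
  have h2 := image_slide_coordCell b I hij.symm (sub_pos.2 hc1) (by linarith)
  have e1 := supportAt_image hn0 hequi hhom (f := slide b i j c) (by rwa [det_slide b hij])
    ⟨_, hconv, hIc, hIn⟩ u
  have e2 := supportAt_image hn0 hequi hhom (f := slide b j i (1 - c))
    (by rw [det_slide b hij.symm]; linarith) ⟨_, hconv, hIc, hIn⟩ u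
  rw [ConvexBody.coe_mk, det_slide b hij, h1] at e1
  rw [ConvexBody.coe_mk, det_slide b hij.symm, h2] at e2
  rw [← e1, ← e2]
  have hcut := supportAt_cut hval u _ hconv hIc g 0
  rw [supportAt_hyperplane hn hr hequi hhom u (coordCell b I ∩ {x | g x = 0})
    (hconv.inter (convex_hyperplane g.toLinearMap.isLinear 0))
    (hIc.inter_right (isClosed_eq g.continuous continuous_const)) g hg0 fun x hx => hx.2,
    add_zero] at hcut
  rw [hcut]
  congr 3
  · ext x
    simp [hg]
  · ext x
    simp [hg]

theorem supportAt_coordCell_eq_zero (hn : 3 ≤ n) (hr : r ≠ 1) (hr2 : r ≠ (n : ℝ) + 1)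
    (hval : IsMinkowskiValuation Φ)
    (hequi : IsSLEquivariant Φ) (hhom : IsHomogeneousOfDegree Φ r)
    (b : Module.Basis (Fin n) ℝ 𝔼) {I : Set ℝ} (hI : Convex ℝ I)
    (hIc : IsCompact (coordCell b I)) (hIn : (coordCell b I).Nonempty) (u : 𝔼) :
    supportAt Φ u (coordCell b I) = 0 := by
  have hcut := fun (i j : Fin n) (hij : i ≠ j) =>
    @supportAt_coordCell_cut n Φ r (by omega) hr hval hequi hhom b I hI hIc hIn i j hij
  have hA : ∀ (i j : Fin n), i ≠ j → ∀ u : 𝔼, inner ℝ (b i) u = inner ℝ (b j) u →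
      supportAt Φ u (coordCell b I) = 0 := by
    intro i j hij u hu
    have hfix : ∀ (k l : Fin n) (c : ℝ), inner ℝ (b k) u = inner ℝ (b l) u →
        LinearMap.adjoint (slide b k l c) u = u := by
      intro k l c h
      refine ext_inner_left ℝ fun x => ?_
      rw [inner_adjoint_slide, h, sub_self, mul_zero, add_zero]
    -- Both adjoint slides fix `u`, so the value equals `2 * (1 / 2) ^ q` times itself, and `q ≠ 1`
    -- because `r ≠ n + 1`.
    have h := hcut i j hij (c := 1 / 2) (by norm_num) (by norm_num) u
    rw [hfix i j _ hu, hfix j i _ hu.symm, show (1 : ℝ) - 1 / 2 = 1 / 2 by norm_num, ← add_mul] at h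
    have hne : (1 / 2 : ℝ) ^ ((r - 1) / n) + (1 / 2 : ℝ) ^ ((r - 1) / n) ≠ 1 := by
      intro h1
      have hhalf : (1 / 2 : ℝ) ^ ((r - 1) / n) = (1 / 2 : ℝ) ^ (1 : ℝ) := by
        rw [Real.rpow_one]; linarith
      have := (Real.rpow_right_inj (by norm_num) (by norm_num)).1 hhalf
      have hn0 : (n : ℝ) ≠ 0 := Nat.cast_ne_zero.2 (by omega)
      rw [div_eq_one_iff_eq hn0] at this
      exact hr2 (by linarith)
    by_contra h0
    exact hne (mul_right_cancel₀ h0 (by rw [one_mul]; exact h.symm))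
  have hB : ∀ i j k : Fin n, i ≠ j → k ≠ i → k ≠ j → inner ℝ (b i) u < inner ℝ (b k) u →
      inner ℝ (b k) u < inner ℝ (b j) u → supportAt Φ u (coordCell b I) = 0 := by
    intro i j k hij hki hkj h1 h2
    have hd : 0 < inner ℝ (b j) u - inner ℝ (b i) u := by linarith
    -- With this `c`, the point `c bᵢ + (1 - c) bⱼ` pairs with `u` to the same value as `bₖ`. Each
    -- adjoint slide therefore gives a vector agreeing on two basis vectors, where `hA` applies.
    set c : ℝ := (inner ℝ (b j) u - inner ℝ (b k) u) / (inner ℝ (b j) u - inner ℝ (b i) u) with hc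
    have hcd : c * (inner ℝ (b j) u - inner ℝ (b i) u) = inner ℝ (b j) u - inner ℝ (b k) u :=
      div_mul_cancel₀ _ hd.ne'
    have hc0 : 0 < c := div_pos (by linarith) hd
    have hc1 : c < 1 := by rw [hc, div_lt_one hd]; linarith
    rw [hcut i j hij hc0 hc1 u, hA i k hki.symm, hA j k hkj.symm, mul_zero, mul_zero, add_zero]
    · simp only [inner_adjoint_slide, Module.Basis.repr_self, Finsupp.single_apply, if_true,
        if_neg hkj]
      linarith
    · simp only [inner_adjoint_slide, Module.Basis.repr_self, Finsupp.single_apply, if_true,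
        if_neg hki]
      linarith
  obtain ⟨i, j, k, hij, hik, hjk⟩ : ∃ i j k : Fin n, i ≠ j ∧ i ≠ k ∧ j ≠ k :=
    ⟨⟨0, by omega⟩, ⟨1, by omega⟩, ⟨2, by omega⟩, by simp, by simp, by simp⟩
  rcases lt_trichotomy (inner ℝ (b i) u) (inner ℝ (b j) u) with h1 | h1 | h1
  · rcases lt_trichotomy (inner ℝ (b j) u) (inner ℝ (b k) u) with h2 | h2 | h2
    · exact hB i k j hik hij.symm hjk h1 h2
    · exact hA j k hjk u h2
    · rcases lt_trichotomy (inner ℝ (b i) u) (inner ℝ (b k) u) with h3 | h3 | h3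
      · exact hB i j k hij hik.symm hjk.symm h3 h2
      · exact hA i k hik u h3
      · exact hB k j i hjk.symm hik hij h3 h1
  · exact hA i j hij u h1
  · rcases lt_trichotomy (inner ℝ (b j) u) (inner ℝ (b k) u) with h2 | h2 | h2
    · rcases lt_trichotomy (inner ℝ (b i) u) (inner ℝ (b k) u) with h3 | h3 | h3
      · exact hB j k i hjk hij hik h1 h3
      · exact hA i k hik u h3
      · exact hB j i k hij.symm hjk.symm hik.symm h2 h3
    · exact hA j k hjk u h2
    · exact hB k i j hik.symm hjk hij.symm h2 h1

/-- Either the at most `n` nonzero points form a basis, or everything lies in a linear hyperplane.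
Whether `0 ∈ X` decides between `I = [0, 1]` and `I = {1}`. -/
theorem supportAt_convexHull_finite (hn : 3 ≤ n) (hr : r ≠ 1) (hr2 : r ≠ (n : ℝ) + 1)
    (hval : IsMinkowskiValuation Φ) (hequi : IsSLEquivariant Φ) (hhom : IsHomogeneousOfDegree Φ r)
    (u : 𝔼) (X : Set 𝔼) (hX : X.Finite) (hcard : (X \ {0}).ncard ≤ n) :
    supportAt Φ u (convexHull ℝ X) = 0 := by
  by_cases hspan : Submodule.span ℝ X = ⊤
  · have hspan' : ⊤ ≤ Submodule.span ℝ (Set.range ((↑) : ↥(X \ {0}) → 𝔼)) := by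
      rw [Subtype.range_coe, Submodule.span_sdiff_singleton_zero, hspan]
    have hfin : (X \ {0}).Finite := hX.subset Set.sdiff_subset
    have : Fintype ↥(X \ {0}) := hfin.fintype
    have hle : Fintype.card ↥(X \ {0}) ≤ n := by
      rwa [← Nat.card_eq_fintype_card, Nat.card_coe_set_eq]
    have hge : n ≤ Fintype.card ↥(X \ {0}) := by
      have := finrank_range_le_card (R := ℝ) ((↑) : ↥(X \ {0}) → 𝔼)
      rw [Set.finrank, top_le_iff.1 hspan', finrank_top, finrank_euclideanSpace_fin] at this
      exact this
    have hcard' : Fintype.card ↥(X \ {0}) = n := le_antisymm hle hge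
    let b := (basisOfTopLeSpanOfCardEqFinrank _ hspan'
      (by rw [hcard', finrank_euclideanSpace_fin])).reindex (Fintype.equivFinOfCardEq hcard')
    have hb : Set.range b = X \ {0} := by
      simp [b]
      rfl
    have hXn : X.Nonempty := by
      rw [Set.nonempty_iff_ne_empty]
      rintro rfl
      simp at hcard'
      omega
    have hc := hX.isCompact_convexHull ℝ
    have hne := hXn.convexHull (𝕜 := ℝ)
    by_cases h0 : (0 : 𝔼) ∈ X
    · have hXe : X = insert 0 (Set.range b) := by
        rw [hb, Set.insert_sdiff_singleton, Set.insert_eq_of_mem h0]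
      have he : convexHull ℝ X = coordCell b (Set.Icc 0 1) := by
        rw [← convexHull_insert_zero_range_basis, ← hXe]
      rw [he] at hc hne ⊢
      exact supportAt_coordCell_eq_zero hn hr hr2 hval hequi hhom b (convex_Icc 0 1) hc hne u
    · have hXe : X = Set.range b := by rw [hb, Set.sdiff_singleton_eq_self h0]
      have he : convexHull ℝ X = coordCell b {1} := by
        rw [← convexHull_range_basis, ← hXe]
      rw [he] at hc hne ⊢
      exact supportAt_coordCell_eq_zero hn hr hr2 hval hequi hhom b (convex_singleton 1) hc hne u
  · obtain ⟨g, hg0, hg⟩ := Submodule.exists_le_ker_of_lt_top _ (lt_top_iff_ne_top.2 hspan)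
    refine supportAt_hyperplane (by omega) hr hequi hhom u _ (convex_convexHull ℝ X)
      (hX.isCompact_convexHull ℝ) (LinearMap.toContinuousLinearMap g) (by simpa using hg0) ?_
    intro x hx
    exact hg (convexHull_min Submodule.subset_span (Submodule.span ℝ X).convex hx)

theorem isSimplexNull_supportAt (hn : 3 ≤ n) (hr : r ≠ 1) (hr2 : r ≠ (n : ℝ) + 1)
    (hval : IsMinkowskiValuation Φ) (hequi : IsSLEquivariant Φ) (hhom : IsHomogeneousOfDegree Φ r)
    (u : 𝔼) : IsSimplexNull (supportAt Φ u) where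
  empty := supportAt_empty Φ u
  cut := supportAt_cut hval u
  hyperplane := supportAt_hyperplane (by omega) hr hequi hhom u
  simplex X hX hc := supportAt_convexHull_finite hn hr hr2 hval hequi hhom u X hX
    (by rwa [finrank_euclideanSpace_fin] at hc)

/-- Outer approximation of a convex body by polytopes. -/
theorem exists_polytope_approx (K : Body n) {ε : ℝ} (hε : 0 < ε) :
    ∃ (R : ℝ) (B : List (𝔼 →L[ℝ] ℝ)) (P : List ((𝔼 →L[ℝ] ℝ) × ℝ)), 0 < R ∧
      Bornology.IsBounded {x : 𝔼 | ∀ f ∈ B, f x ≤ R} ∧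
      (K : Set 𝔼) ⊆ {x | ∀ f ∈ B, f x ≤ R} ∩ {x | ∀ p ∈ P, p.1 x ≤ p.2} ∧
      {x | ∀ f ∈ B, f x ≤ R} ∩ {x | ∀ p ∈ P, p.1 x ≤ p.2} ⊆ Metric.thickening ε (K : Set 𝔼) := by
  obtain ⟨R₀, hR₀⟩ := K.isBounded.exists_norm_le
  have hR₀' : 0 ≤ R₀ := K.nonempty.elim fun x hx => (norm_nonneg _).trans (hR₀ x hx)
  -- The extra `1` keeps `R` positive even for `K = {0}`.
  set R := R₀ + 1
  let B : List (𝔼 →L[ℝ] ℝ) := (List.finRange n).map (fun i => EuclideanSpace.proj i) ++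
    (List.finRange n).map (fun i => -EuclideanSpace.proj i)
  have hB : ∀ x : 𝔼, (∀ f ∈ B, f x ≤ R) ↔ ∀ i, |x i| ≤ R := by
    intro x
    simp [B, or_imp, forall_and, abs_le, neg_le]
    tauto
  have hBb : Bornology.IsBounded {x : 𝔼 | ∀ f ∈ B, f x ≤ R} := by
    refine isBounded_iff_forall_norm_le.2 ⟨√(∑ _i : Fin n, R ^ 2), fun x hx => ?_⟩
    rw [EuclideanSpace.norm_eq]
    refine Real.sqrt_le_sqrt (Finset.sum_le_sum fun i _ => ?_)
    exact pow_le_pow_left₀ (norm_nonneg _) ((hB x).1 hx i) 2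
  have hKB : (K : Set 𝔼) ⊆ {x | ∀ f ∈ B, f x ≤ R} := fun x hx => (hB x).2 fun i => by
    have h1 := PiLp.norm_apply_le x i
    rw [Real.norm_eq_abs] at h1
    linarith [hR₀ x hx]
  -- The part of the box away from `K` is compact, so finitely many separating halfspaces exclude
  -- it.
  have hN : IsCompact ({x : 𝔼 | ∀ f ∈ B, f x ≤ R} \ Metric.thickening ε (K : Set 𝔼)) :=
    (Metric.isCompact_of_isClosed_isBounded (isClosed_setOf_forall_le B R) hBb).diff
      Metric.isOpen_thickening
  have hsep : ∀ x : 𝔼, ∃ p : (𝔼 →L[ℝ] ℝ) × ℝ, x ∉ (K : Set 𝔼) →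
      (∀ a ∈ (K : Set 𝔼), p.1 a < p.2) ∧ p.2 < p.1 x := by
    intro x
    by_cases hx : x ∈ (K : Set 𝔼)
    · exact ⟨0, fun h => absurd hx h⟩
    · obtain ⟨f, c, h1, h2⟩ := geometric_hahn_banach_closed_point K.convex K.isClosed hx
      exact ⟨(f, c), fun _ => ⟨h1, h2⟩⟩
  choose p hp using hsep
  have hnot : ∀ x ∈ {x : 𝔼 | ∀ f ∈ B, f x ≤ R} \ Metric.thickening ε (K : Set 𝔼),
      x ∉ (K : Set 𝔼) := fun x hx h => hx.2 (Metric.self_subset_thickening hε _ h)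
  obtain ⟨t, htN, ht⟩ := hN.elim_nhds_subcover (fun x => {y | (p x).2 < (p x).1 y}) fun x hx =>
    (isOpen_lt continuous_const (p x).1.continuous).mem_nhds (hp x (hnot x hx)).2
  refine ⟨R, B, t.toList.map p, by positivity, hBb, Set.subset_inter hKB ?_, ?_⟩
  · intro a ha q hq
    obtain ⟨x, hx, rfl⟩ := List.mem_map.1 hq
    exact ((hp x (hnot x (htN x (Finset.mem_toList.1 hx)))).1 a ha).le
  · rintro y ⟨hyB, hyP⟩
    by_contra hy
    obtain ⟨x, hx, hxy⟩ := Set.mem_iUnion₂.1 (ht ⟨hyB, hy⟩)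
    exact absurd (hyP (p x) (List.mem_map_of_mem (Finset.mem_toList.2 hx))) (not_le.2 hxy)

end SimplexValues

end MinkowskiValuation

theorem mainTheorem4 (n : ℕ) (hn : 3 ≤ n) (r : ℝ) (hr1 : r ≠ 1) (hr2 : r ≠ (n : ℝ) + 1)
    (Φ : MinkowskiValuation.Body n → MinkowskiValuation.Body n)
    (hval : MinkowskiValuation.IsMinkowskiValuation Φ)
    (hcont : Continuous Φ)
    (hequi : MinkowskiValuation.IsSLEquivariant Φ)
    (hhom : MinkowskiValuation.IsHomogeneousOfDegree Φ r)
    (K : MinkowskiValuation.Body n) :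
    (Φ K : Set (EuclideanSpace ℝ (Fin n))) = {0} := by
  open MinkowskiValuation in
  -- Continuity enters only here: the bodies sent to `0` form a closed set, which contains the
  -- approximating polytopes.
  have hcl : IsClosed (Φ ⁻¹' {0}) := isClosed_singleton.preimage hcont
  have hK : K ∈ closure (Φ ⁻¹' {0}) := by
    refine Metric.mem_closure_iff.2 fun ε hε => ?_
    obtain ⟨R, B, P, hR, hB, hKP, hPK⟩ := exists_polytope_approx K (half_pos hε)
    set Q := {x | ∀ f ∈ B, f x ≤ R} ∩ {x | ∀ p ∈ P, p.1 x ≤ p.2} with hQ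
    have hPc : Convex ℝ {x : EuclideanSpace ℝ (Fin n) | ∀ p ∈ P, p.1 x ≤ p.2} := by
      simp only [Set.ofPred_forall]
      exact convex_iInter₂ fun p _ => convex_halfSpace_le p.1.toLinearMap.isLinear p.2
    have hPcl : IsClosed {x : EuclideanSpace ℝ (Fin n) | ∀ p ∈ P, p.1 x ≤ p.2} := by
      simp only [Set.ofPred_forall]
      exact isClosed_biInter fun p _ => isClosed_le p.1.continuous continuous_const
    have hQc : Convex ℝ Q := (convex_setOf_forall_le B R).inter hPc
    have hQk : IsCompact Q := Metric.isCompact_of_isClosed_isBounded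
      ((isClosed_setOf_forall_le B R).inter hPcl) (hB.subset Set.inter_subset_left)
    let L : Body n := ⟨Q, hQc, hQk, K.nonempty.mono hKP⟩
    refine ⟨L, ?_, ?_⟩
    · refine eq_zero_of_support_eq_zero fun u => ?_
      rw [← supportAt_coe]
      exact (isSimplexNull_supportAt hn hr1 hr2 hval hequi hhom u).polyhedron P R hR B hB
    · rw [← ConvexBody.hausdorffDist_coe]
      refine lt_of_le_of_lt (Metric.hausdorffDist_le_of_mem_dist (half_pos hε).le ?_ ?_)
        (half_lt_self hε)
      · exact fun x hx => ⟨x, hKP hx, by simpa using (half_pos hε).le⟩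
      · intro x hx
        obtain ⟨y, hy, hxy⟩ := Metric.mem_thickening_iff.1 (hPK hx)
        exact ⟨y, hy, hxy.le⟩
  rw [hcl.closure_eq] at hK
  rw [show Φ K = 0 from hK, ConvexBody.coe_zero]
  rfl
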